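/- Let $r\ge 2$ and $d\ge 0$, let $T\subset\mathbb{R}$ be a nonempty open interval and let $Q$ be a connected, paracompact, Hausdorff $d$-dimensional manifold without boundary of class $C^{r+1}$. Let $a_t$ be a positive definite metric, $b_t$ a 1-form field and $V(t,\cdot)$ a function on $Q$, all possibly depending on the time $t\in T$ and all of class $C^r$ jointly in $(t,q)\in T\times Q$, and let $$L(t,q,v)=\tfrac12\, a_t(v,v)+b_t(v)-V(t,q),\qquad t\in T,\ q\in Q,\ v\in T_qQ,$$ be the corresponding Lagrangian. Consider the spacetime $M=T\times Q\times\mathbb{R}$, with points $(t,q,y)$, Lorentzian metric $$g=a_t-dt\otimes(dy-b_t)-(dy-b_t)\otimes dt-2V\,dt^2,$$ of signature $(-,+,\dots,+)$, and time orientation given by the timelike vector field $W=\partial_t-(V-\tfrac12)\,\partial_y$. A tangent vector $u$ is future directed timelike if $g(u,u)<0$ and $g(u,W)<0$. For $x,z\in M$ write $z\in I^+(x)$, equivalently $x\in I^-(z)$, if there is a piecewise $C^1$ curve from $x$ to $z$ with future directed timelike velocity (one-sided velocities at the corners and at the endpoints). Theorem. If the Lagrangian does not depend on time, that is $L(t,q,v)=L(s,q,v)$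 for all $t,s\in T$, $q\in Q$, $v\in T_qQ$, then $(M,g)$ is reflective, both past and future: for all $x,z\in M$, $$z\in\overline{I^+(x)}\implies x\in\overline{I^-(z)}\quad\text{(past reflectivity)},\qquad x\in\overline{I^-(z)}\implies z\in\overline{I^+(x)}\quad\text{(future reflectivity)}.$$ -/

import Mathlib

open Set Topology
open scoped Manifold ContDiff

noncomputable section

/-! ## Chronology of a time-oriented manifold with a field of bilinear forms -/

section Chronology

variable {E : Type*} [NormedAddCommGroup E] [NormedSpace ℝ E]
  {H : Type*} [TopologicalSpace H] (J : ModelWithCorners ℝ E H)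
  {M : Type*} [TopologicalSpace M] [ChartedSpace H M]

/-- `v ∈ T_x M` is timelike and future directed, for the metric `g` of signature `(-,+,…,+)` and the
time orientation given by the timelike vector field `W`. -/
def IsFutureTimelike (g : ∀ x : M, TangentSpace J x →L[ℝ] TangentSpace J x →L[ℝ] ℝ)
    (W : ∀ x : M, TangentSpace J x) (x : M) (v : TangentSpace J x) : Prop :=
  g x v v < 0 ∧ g x v (W x) < 0

/-- There is a `C^1` future directed timelike curve `γ : [a, b] → M` from `x` to `y`. At the
endpoints of `[a, b]` the velocity is the one-sided derivative. -/
def TimelikeArc (g : ∀ x : M, TangentSpace J x →L[ℝ] TangentSpace J x →L[ℝ] ℝ)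
    (W : ∀ x : M, TangentSpace J x) (x y : M) : Prop :=
  ∃ (a b : ℝ) (γ : ℝ → M), a < b ∧ γ a = x ∧ γ b = y ∧
    ContMDiffOn 𝓘(ℝ, ℝ) J 1 γ (Icc a b) ∧
    ∀ s ∈ Icc a b,
      IsFutureTimelike J g W (γ s) (mfderivWithin 𝓘(ℝ, ℝ) J γ (Icc a b) s (1 : ℝ))

/-- The chronological relation `x ≪ y`: there is a piecewise `C^1` future directed timelike curve
from `x` to `y`, i.e. a concatenation of finitely many (at least one) `C^1` timelike curves. -/
def Chronological (g : ∀ x : M, TangentSpace J x →L[ℝ] TangentSpace J x →L[ℝ] ℝ)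
    (W : ∀ x : M, TangentSpace J x) (x y : M) : Prop :=
  Relation.TransGen (TimelikeArc J g W) x y

/-- The chronological future `I⁺(x)`. -/
def chronFuture (g : ∀ x : M, TangentSpace J x →L[ℝ] TangentSpace J x →L[ℝ] ℝ)
    (W : ∀ x : M, TangentSpace J x) (x : M) : Set M :=
  {y | Chronological J g W x y}

/-- The chronological past `I⁻(y)`. -/
def chronPast (g : ∀ x : M, TangentSpace J x →L[ℝ] TangentSpace J x →L[ℝ] ℝ)
    (W : ∀ x : M, TangentSpace J x) (y : M) : Set M :=
  {x | Chronological J g W x y}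

/-- Future reflectivity. -/
def FutureReflective (g : ∀ x : M, TangentSpace J x →L[ℝ] TangentSpace J x →L[ℝ] ℝ)
    (W : ∀ x : M, TangentSpace J x) : Prop :=
  ∀ x y : M, x ∈ closure (chronPast J g W y) → y ∈ closure (chronFuture J g W x)

/-- Past reflectivity. -/
def PastReflective (g : ∀ x : M, TangentSpace J x →L[ℝ] TangentSpace J x →L[ℝ] ℝ)
    (W : ∀ x : M, TangentSpace J x) : Prop :=
  ∀ x y : M, y ∈ closure (chronFuture J g W x) → x ∈ closure (chronPast J g W y)

/-- Reflectivity: both past and future reflectivity. -/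
def Reflective (g : ∀ x : M, TangentSpace J x →L[ℝ] TangentSpace J x →L[ℝ] ℝ)
    (W : ∀ x : M, TangentSpace J x) : Prop :=
  PastReflective J g W ∧ FutureReflective J g W

end Chronology

/-! ## Mechanical systems and their spacetimes -/

/-- The data of a classical mechanical system on the space `Q` over the time interval `T`: a time
dependent positive definite metric `a_t`, a time dependent 1-form field `b_t` and a potential
`V(t, q)`, all of class `C^r` jointly in `(t, q)`. -/
structure MechanicalSystem (r : ℕ∞ω) (d : ℕ) (T : TopologicalSpace.Opens ℝ) (Q : Type*)
    [TopologicalSpace Q] [ChartedSpace (EuclideanSpace ℝ (Fin d)) Q]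
    [IsManifold (𝓡 d) 1 Q] where
  /-- the time dependent metric -/
  a : T → ∀ q : Q, TangentSpace (𝓡 d) q →L[ℝ] TangentSpace (𝓡 d) q →L[ℝ] ℝ
  /-- the time dependent 1-form -/
  b : T → ∀ q : Q, TangentSpace (𝓡 d) q →L[ℝ] ℝ
  /-- the potential -/
  V : T → Q → ℝ
  a_symm : ∀ (t : T) (q : Q) (v w : TangentSpace (𝓡 d) q), a t q v w = a t q w v
  a_pos : ∀ (t : T) (q : Q) (v : TangentSpace (𝓡 d) q), v ≠ 0 → 0 < a t q v v
  contMDiff_a : ContMDiff (𝓘(ℝ, ℝ).prod (𝓡 d))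
    ((𝓡 d).prod 𝓘(ℝ, EuclideanSpace ℝ (Fin d) →L[ℝ] EuclideanSpace ℝ (Fin d) →L[ℝ] ℝ)) r
    (fun e : T × Q ↦ Bundle.TotalSpace.mk'
      (EuclideanSpace ℝ (Fin d) →L[ℝ] EuclideanSpace ℝ (Fin d) →L[ℝ] ℝ)
      (E := fun q : Q ↦ TangentSpace (𝓡 d) q →L[ℝ] TangentSpace (𝓡 d) q →L[ℝ] ℝ)
      e.2 (a e.1 e.2))
  contMDiff_b : ContMDiff (𝓘(ℝ, ℝ).prod (𝓡 d))
    ((𝓡 d).prod 𝓘(ℝ, EuclideanSpace ℝ (Fin d) →L[ℝ] ℝ)) r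
    (fun e : T × Q ↦ Bundle.TotalSpace.mk' (EuclideanSpace ℝ (Fin d) →L[ℝ] ℝ)
      (E := fun q : Q ↦ TangentSpace (𝓡 d) q →L[ℝ] ℝ)
      e.2 (b e.1 e.2))
  contMDiff_V : ContMDiff (𝓘(ℝ, ℝ).prod (𝓡 d)) 𝓘(ℝ, ℝ) r (fun e : T × Q ↦ V e.1 e.2)

/-- The model with corners of the `(d + 1) + 1`-dimensional manifold `T × Q × ℝ`. -/
abbrev spacetimeModel (d : ℕ) : ModelWithCorners ℝ (ℝ × EuclideanSpace ℝ (Fin d) × ℝ)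
    (ModelProd ℝ (ModelProd (EuclideanSpace ℝ (Fin d)) ℝ)) :=
  𝓘(ℝ, ℝ).prod ((𝓡 d).prod 𝓘(ℝ, ℝ))

namespace MechanicalSystem

variable {r : ℕ∞ω} {d : ℕ} {T : TopologicalSpace.Opens ℝ} {Q : Type*}
  [TopologicalSpace Q] [ChartedSpace (EuclideanSpace ℝ (Fin d)) Q] [IsManifold (𝓡 d) 1 Q]

/-- The Lagrangian `L(t, q, v) = ½ a_t(v, v) + b_t(v) - V(t, q)`. -/
def lagrangian (S : MechanicalSystem r d T Q) (t : T) (q : Q) (v : TangentSpace (𝓡 d) q) : ℝ :=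
  1 / 2 * S.a t q v v + S.b t q v - S.V t q

/-- The Lagrangian does not depend on time. -/
def IsAutonomous (S : MechanicalSystem r d T Q) : Prop :=
  ∀ (t s : T) (q : Q) (v : TangentSpace (𝓡 d) q), S.lagrangian t q v = S.lagrangian s q v

/-- The 1-form `dt` on `T × Q × ℝ`. Here and below, `T_{(t,q,y)}(T × Q × ℝ)` is `ℝ × T_q Q × ℝ`. -/
def dt (x : T × Q × ℝ) : TangentSpace (spacetimeModel d) x →L[ℝ] ℝ :=
  ContinuousLinearMap.fst ℝ ℝ (EuclideanSpace ℝ (Fin d) × ℝ)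

/-- The tangent map `T_{(t,q,y)}(T × Q × ℝ) → T_q Q` of the projection to `Q`. -/
def dq (x : T × Q × ℝ) :
    TangentSpace (spacetimeModel d) x →L[ℝ] TangentSpace (𝓡 d) x.2.1 :=
  (ContinuousLinearMap.fst ℝ (EuclideanSpace ℝ (Fin d)) ℝ).comp
    (ContinuousLinearMap.snd ℝ ℝ (EuclideanSpace ℝ (Fin d) × ℝ))

/-- The 1-form `dy` on `T × Q × ℝ`. -/
def dy (x : T × Q × ℝ) : TangentSpace (spacetimeModel d) x →L[ℝ] ℝ :=
  (ContinuousLinearMap.snd ℝ (EuclideanSpace ℝ (Fin d)) ℝ).comp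
    (ContinuousLinearMap.snd ℝ ℝ (EuclideanSpace ℝ (Fin d) × ℝ))

/-- The vector field `∂_t` on `T × Q × ℝ`. -/
def partialT (x : T × Q × ℝ) : TangentSpace (spacetimeModel d) x :=
  ((1, 0, 0) : ℝ × EuclideanSpace ℝ (Fin d) × ℝ)

/-- The vector field `∂_y` on `T × Q × ℝ`. -/
def partialY (x : T × Q × ℝ) : TangentSpace (spacetimeModel d) x :=
  ((0, 0, 1) : ℝ × EuclideanSpace ℝ (Fin d) × ℝ)

/-- The 1-form `dy - b_t` on `T × Q × ℝ`. -/
def connectionForm (S : MechanicalSystem r d T Q) (x : T × Q × ℝ) :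
    TangentSpace (spacetimeModel d) x →L[ℝ] ℝ :=
  dy x - (S.b x.1 x.2.1).comp (dq x)

/-- The spacetime metric `g = a_t - dt ⊗ (dy - b_t) - (dy - b_t) ⊗ dt - 2 V dt²` on
`M = T × Q × ℝ`. Here `a_t` stands for its pullback `(u, v) ↦ a_t(dq u, dq v)`,
and the tensor product of 1-forms `α ⊗ β` is `α.smulRight β : u ↦ α(u) β`. -/
def metric (S : MechanicalSystem r d T Q) (x : T × Q × ℝ) :
    TangentSpace (spacetimeModel d) x →L[ℝ] TangentSpace (spacetimeModel d) x →L[ℝ] ℝ :=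
  (ContinuousLinearMap.precomp ℝ (dq x)).comp ((S.a x.1 x.2.1).comp (dq x))
    - (dt x).smulRight (S.connectionForm x) - (S.connectionForm x).smulRight (dt x)
    - (2 * S.V x.1 x.2.1) • (dt x).smulRight (dt x)

/-- The vector field `W = ∂_t - (V - ½) ∂_y` giving the time orientation. -/
def timeOrientation (S : MechanicalSystem r d T Q) (x : T × Q × ℝ) :
    TangentSpace (spacetimeModel d) x :=
  partialT x - (S.V x.1 x.2.1 - 1 / 2) • partialY x

theorem metric_apply (S : MechanicalSystem r d T Q) (x : T × Q × ℝ)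
    (u v : TangentSpace (spacetimeModel d) x) :
    S.metric x u v = S.a x.1 x.2.1 (dq x u) (dq x v)
      - dt x u * (dy x v - S.b x.1 x.2.1 (dq x v))
      - (dy x u - S.b x.1 x.2.1 (dq x u)) * dt x v
      - 2 * S.V x.1 x.2.1 * (dt x u * dt x v) := by
  rfl

theorem metric_symm (S : MechanicalSystem r d T Q) (x : T × Q × ℝ)
    (u v : TangentSpace (spacetimeModel d) x) : S.metric x u v = S.metric x v u := by
  rw [metric_apply, metric_apply, S.a_symm]
  ring

theorem dt_timeOrientation (S : MechanicalSystem r d T Q) (x : T × Q × ℝ) :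
    dt x (S.timeOrientation x) = 1 := by
  change (1 : ℝ) - (S.V x.1 x.2.1 - 1 / 2) * 0 = 1
  ring

theorem dq_timeOrientation (S : MechanicalSystem r d T Q) (x : T × Q × ℝ) :
    dq x (S.timeOrientation x) = 0 := by
  change (0 : EuclideanSpace ℝ (Fin d)) - (S.V x.1 x.2.1 - 1 / 2) • (0 : EuclideanSpace ℝ (Fin d))
    = 0
  simp

theorem dy_timeOrientation (S : MechanicalSystem r d T Q) (x : T × Q × ℝ) :
    dy x (S.timeOrientation x) = 1 / 2 - S.V x.1 x.2.1 := by
  change (0 : ℝ) - (S.V x.1 x.2.1 - 1 / 2) * 1 = _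
  ring

/-- `W` is a unit timelike vector field. -/
theorem metric_timeOrientation (S : MechanicalSystem r d T Q) (x : T × Q × ℝ) :
    S.metric x (S.timeOrientation x) (S.timeOrientation x) = -1 := by
  simp only [metric_apply, dt_timeOrientation, dq_timeOrientation, dy_timeOrientation, map_zero]
  ring

/-- The metric is positive definite on the orthogonal complement of `W`; hence it has signature
`(-,+,…,+)`. -/
theorem metric_pos_of_orthogonal (S : MechanicalSystem r d T Q) (x : T × Q × ℝ)
    (u : TangentSpace (spacetimeModel d) x) (hu : u ≠ 0)
    (h : S.metric x u (S.timeOrientation x) = 0) : 0 < S.metric x u u := by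
  simp only [metric_apply, dt_timeOrientation, dq_timeOrientation, dy_timeOrientation,
    map_zero] at h
  have h2 : S.metric x u u = S.a x.1 x.2.1 (dq x u) (dq x u) + dt x u ^ 2 := by
    rw [metric_apply]
    linear_combination (2 * dt x u) * h
  rw [h2]
  by_cases hq : dq x u = 0
  · have ht : dt x u ≠ 0 := by
      intro ht
      apply hu
      simp only [ht, hq, map_zero] at h
      have hy : dy x u = 0 := by linarith
      exact Prod.ext ht (Prod.ext hq hy)
    rw [hq]
    simp only [map_zero, zero_add]
    positivity
  · have := S.a_pos x.1 x.2.1 _ hq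
    positivity

end MechanicalSystem

end

/-!
When nothing depends on time, `∂_t + c ∂_y` is a Killing field, which is timelike near a given point
once `c` is large. Its local flow `φ^σ` preserves `≪`, and for small `σ > 0` every `p` close enough
to `z` satisfies `p ≪ φ^σ z`, because in a chart the segment from `p` to `φ^σ z` has nearly the
direction of the field. If `z ∈ closure I⁺(x)`, some such `p` lies in `I⁺(x)`, so `x ≪ φ^σ z` and
`φ^{-σ} x ≪ z`; now let `σ → 0`. Future reflectivity is the same argument with `σ < 0`.
-/

section TangentSpace

variable {𝕜 : Type*} [NontriviallyNormedField 𝕜]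
  {E : Type*} [NormedAddCommGroup E] [NormedSpace 𝕜 E] {H : Type*} [TopologicalSpace H]
  {I : ModelWithCorners 𝕜 E H} {M : Type*} [TopologicalSpace M] [ChartedSpace H M]
  {E' : Type*} [NormedAddCommGroup E'] [NormedSpace 𝕜 E'] {H' : Type*} [TopologicalSpace H']
  {I' : ModelWithCorners 𝕜 E' H'} {N : Type*} [TopologicalSpace N] [ChartedSpace H' N]

theorem hasMFDerivAt_subtypeVal_comp_iff {U : TopologicalSpace.Opens N} {f : M → U} {x : M}
    {f' : TangentSpace I x →L[𝕜] TangentSpace I' (f x)} :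
    HasMFDerivAt I I' (Subtype.val ∘ f) x f' ↔ HasMFDerivAt I I' f x f' :=
  and_congr_left' IsInducing.subtypeVal.continuousAt_iff.symm

theorem hasMFDerivAt_subtypeVal {U : TopologicalSpace.Opens N} (x : U) :
    HasMFDerivAt I' I' (Subtype.val : U → N) x (ContinuousLinearMap.id 𝕜 E') :=
  hasMFDerivAt_subtypeVal_comp_iff (f := id).2 (hasMFDerivAt_id x)

theorem contMDiffAt_subtypeVal_comp_iff {n : ℕ∞ω} {U : TopologicalSpace.Opens N} {f : M → U}
    {x : M} : ContMDiffAt I I' n (Subtype.val ∘ f) x ↔ ContMDiffAt I I' n f x :=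
  ChartedSpace.liftPropWithinAt_subtypeVal_comp_iff ..

theorem continuous_mfderiv_apply [IsManifold I 1 M] {f : M → E'}
    (hf : ContMDiff I 𝓘(𝕜, E') 1 f) :
    Continuous fun p : TangentBundle I M ↦ (mfderiv I 𝓘(𝕜, E') f p.proj p.2 : E') :=
  (contMDiff_snd_tangentBundle_modelSpace E' 𝓘(𝕜, E') (n := 0)).continuous.comp
    (hf.continuous_tangentMap le_rfl)

theorem mfderivWithin_target_extChartAt_symm [I.Boundaryless] [IsManifold I 1 M] (x : M) :
    mfderivWithin 𝓘(𝕜, E) I (extChartAt I x).symm (extChartAt I x).target (extChartAt I x x) =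
      ContinuousLinearMap.id 𝕜 E := by
  rw [mfderivWithin_of_mem_nhds (extChartAt_target_mem_nhds x), ← mfderivWithin_univ,
    ← I.range_eq_univ]
  exact mfderivWithin_range_extChartAt_symm

theorem tendsto_slope_extChartAt {ζ : 𝕜 → M} {t : 𝕜} {u : TangentSpace I (ζ t)}
    (h : HasMFDerivAt 𝓘(𝕜, 𝕜) I ζ t (ContinuousLinearMap.toSpanSingleton 𝕜 u)) :
    Filter.Tendsto (slope (extChartAt I (ζ t) ∘ ζ) t) (𝓝[≠] t) (𝓝 u) := by
  have h' : HasFDerivWithinAt (extChartAt I (ζ t) ∘ ζ)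
    (ContinuousLinearMap.toSpanSingleton 𝕜 (M₁ := E) u) (range 𝓘(𝕜, 𝕜)) t := h.2
  rw [modelWithCornersSelf_coe, range_id, hasFDerivWithinAt_univ] at h'
  exact hasDerivAt_iff_tendsto_slope.1 (hasDerivAt_iff_hasFDerivAt.2 h')

end TangentSpace

section Chronology

variable {E : Type*} [NormedAddCommGroup E] [NormedSpace ℝ E]
  {H : Type*} [TopologicalSpace H] {J : ModelWithCorners ℝ E H}
  {M : Type*} [TopologicalSpace M] [ChartedSpace H M]
  {g : ∀ x : M, TangentSpace J x →L[ℝ] TangentSpace J x →L[ℝ] ℝ} {W : ∀ x : M, TangentSpace J x}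

variable (J g W) in
/-- A temporal function: a differentiable function whose differential is positive on the future
directed timelike vectors. -/
structure IsTemporal (τ : M → ℝ) : Prop where
  mdifferentiable : MDifferentiable J 𝓘(ℝ, ℝ) τ
  mfderiv_pos : ∀ (x : M) (u : TangentSpace J x), IsFutureTimelike J g W x u →
    (0 : ℝ) < mfderiv J 𝓘(ℝ, ℝ) τ x u

namespace IsTemporal

variable {τ : M → ℝ}

theorem strictMonoOn_comp (hτ : IsTemporal J g W τ) {γ : ℝ → M} {a b : ℝ}
    (hγ : ContMDiffOn 𝓘(ℝ, ℝ) J 1 γ (Icc a b))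
    (h : ∀ s ∈ Icc a b,
      IsFutureTimelike J g W (γ s) (mfderivWithin 𝓘(ℝ, ℝ) J γ (Icc a b) s (1 : ℝ))) :
    StrictMonoOn (τ ∘ γ) (Icc a b) := by
  refine strictMonoOn_of_deriv_pos (convex_Icc a b)
    (hτ.mdifferentiable.continuous.comp_continuousOn hγ.continuousOn) fun s hs ↦ ?_
  rw [interior_Icc] at hs
  have hnhds : Icc a b ∈ 𝓝 s := Icc_mem_nhds hs.1 hs.2
  have hs' := Ioo_subset_Icc_self hs
  have hγs : MDifferentiableAt 𝓘(ℝ, ℝ) J γ s :=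
    ((hγ s hs').contMDiffAt hnhds).mdifferentiableAt one_ne_zero
  have hpos := hτ.mfderiv_pos _ _ (h s hs')
  rw [mfderivWithin_of_mem_nhds hnhds] at hpos
  rw [← fderiv_apply_one_eq_deriv, ← mfderiv_eq_fderiv, mfderiv_comp s (hτ.mdifferentiable _) hγs]
  exact hpos

theorem lt_of_timelikeArc (hτ : IsTemporal J g W τ) {x z : M} (h : TimelikeArc J g W x z) :
    τ x < τ z := by
  obtain ⟨a, b, γ, hab, rfl, rfl, hγ, hγ'⟩ := h
  exact hτ.strictMonoOn_comp hγ hγ' (left_mem_Icc.2 hab.le) (right_mem_Icc.2 hab.le) hab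

theorem lt_of_chronological (hτ : IsTemporal J g W τ) {x z : M} (h : Chronological J g W x z) :
    τ x < τ z := by
  induction h with
  | single h => exact hτ.lt_of_timelikeArc h
  | tail _ h ih => exact ih.trans (hτ.lt_of_timelikeArc h)

end IsTemporal

section Map

variable {E' : Type*} [NormedAddCommGroup E'] [NormedSpace ℝ E']
  {H' : Type*} [TopologicalSpace H'] {J' : ModelWithCorners ℝ E' H'}
  {M' : Type*} [TopologicalSpace M'] [ChartedSpace H' M']
  {g' : ∀ x : M', TangentSpace J' x →L[ℝ] TangentSpace J' x →L[ℝ] ℝ}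
  {W' : ∀ x : M', TangentSpace J' x} {τ : M → ℝ} {f : M → M'} {x z : M}

theorem TimelikeArc.map (hτ : IsTemporal J g W τ)
    (hf : ∀ y, τ y ∈ Icc (τ x) (τ z) → ContMDiffAt J J' 1 f y)
    (hf' : ∀ y, τ y ∈ Icc (τ x) (τ z) → ∀ u, IsFutureTimelike J g W y u →
      IsFutureTimelike J' g' W' (f y) (mfderiv J J' f y u))
    (h : TimelikeArc J g W x z) : TimelikeArc J' g' W' (f x) (f z) := by
  obtain ⟨a, b, γ, hab, rfl, rfl, hγ, hγ'⟩ := h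
  have hmono := (hτ.strictMonoOn_comp hγ hγ').monotoneOn
  have hmem : ∀ s ∈ Icc a b, τ (γ s) ∈ Icc (τ (γ a)) (τ (γ b)) := fun s hs ↦
    ⟨hmono (left_mem_Icc.2 hab.le) hs hs.1, hmono hs (right_mem_Icc.2 hab.le) hs.2⟩
  refine ⟨a, b, f ∘ γ, hab, rfl, rfl,
    fun s hs ↦ (hf _ (hmem s hs)).comp_contMDiffWithinAt s (hγ s hs), fun s hs ↦ ?_⟩
  rw [mfderiv_comp_mfderivWithin s ((hf _ (hmem s hs)).mdifferentiableAt one_ne_zero)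
    ((hγ s hs).mdifferentiableWithinAt one_ne_zero)
    ((uniqueDiffOn_Icc hab).uniqueMDiffOn s hs)]
  exact hf' _ (hmem s hs) _ (hγ' s hs)

theorem Chronological.map (hτ : IsTemporal J g W τ)
    (hf : ∀ y, τ y ∈ Icc (τ x) (τ z) → ContMDiffAt J J' 1 f y)
    (hf' : ∀ y, τ y ∈ Icc (τ x) (τ z) → ∀ u, IsFutureTimelike J g W y u →
      IsFutureTimelike J' g' W' (f y) (mfderiv J J' f y u))
    (h : Chronological J g W x z) : Chronological J' g' W' (f x) (f z) := by
  unfold Chronological at h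
  induction h with
  | single h => exact .single (h.map hτ hf hf')
  | tail hxw hwz ih =>
    have hx := (hτ.lt_of_chronological hxw).le
    have hz := (hτ.lt_of_timelikeArc hwz).le
    exact .tail (ih (fun y hy ↦ hf y (Icc_subset_Icc_right hz hy))
        fun y hy ↦ hf' y (Icc_subset_Icc_right hz hy))
      (hwz.map hτ (fun y hy ↦ hf y (Icc_subset_Icc_left hx hy))
        fun y hy ↦ hf' y (Icc_subset_Icc_left hx hy))

end Map

section Chart

variable [IsManifold J 1 M]

theorem timelikeArc_extChartAt_symm {x : M} {e v : E} {s : ℝ} (hs : 0 < s)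
    (hmem : ∀ σ ∈ Icc 0 s, e + σ • v ∈ (extChartAt J x).target)
    (h : ∀ σ ∈ Icc 0 s, IsFutureTimelike J g W ((extChartAt J x).symm (e + σ • v))
      (mfderivWithin 𝓘(ℝ, E) J (extChartAt J x).symm (extChartAt J x).target (e + σ • v) v)) :
    TimelikeArc J g W ((extChartAt J x).symm e) ((extChartAt J x).symm (e + s • v)) := by
  have hsymm := contMDiffOn_extChartAt_symm (I := J) (n := 1) x
  have hline : ContDiffOn ℝ 1 (fun σ : ℝ ↦ e + σ • v) (Icc 0 s) := by fun_prop
  refine ⟨0, s, (extChartAt J x).symm ∘ fun σ ↦ e + σ • v, hs, by simp, rfl,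
    hsymm.comp hline.contMDiffOn hmem, fun σ hσ ↦ ?_⟩
  have hunique : UniqueMDiffWithinAt 𝓘(ℝ, ℝ) (Icc 0 s) σ :=
    (uniqueDiffOn_Icc hs).uniqueMDiffOn σ hσ
  have hderiv : HasFDerivWithinAt (fun σ : ℝ ↦ e + σ • v)
      (ContinuousLinearMap.toSpanSingleton ℝ v) (Icc 0 s) σ :=
    ((ContinuousLinearMap.toSpanSingleton ℝ v).hasFDerivWithinAt).const_add e
  have hcomp := mfderivWithin_comp σ
    ((hsymm _ (hmem σ hσ)).mdifferentiableWithinAt one_ne_zero)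
    hderiv.hasMFDerivWithinAt.mdifferentiableWithinAt hmem hunique
  rw [hderiv.hasMFDerivWithinAt.mfderivWithin hunique] at hcomp
  rw [hcomp]
  convert! h σ hσ using 1
  exact congrArg (mfderivWithin 𝓘(ℝ, E) J (extChartAt J x).symm (extChartAt J x).target _)
    (one_smul ℝ v)

variable [J.Boundaryless]

theorem eventually_isFutureTimelike_mfderivWithin_extChartAt_symm
    (hopen : IsOpen {p : TangentBundle J M | IsFutureTimelike J g W p.proj p.2})
    {x : M} {u : TangentSpace J x} (hu : IsFutureTimelike J g W x u) :
    ∀ᶠ w : E × E in 𝓝 (extChartAt J x x, u),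
      IsFutureTimelike J g W ((extChartAt J x).symm w.1)
        (mfderivWithin 𝓘(ℝ, E) J (extChartAt J x).symm (extChartAt J x).target w.1 w.2) := by
  set F := tangentMapWithin 𝓘(ℝ, E) J (extChartAt J x).symm (extChartAt J x).target
  have hU : IsOpen (extChartAt J x).target := isOpen_extChartAt_target x
  have hF : ContinuousAt F ⟨extChartAt J x x, u⟩ :=
    ((contMDiffOn_extChartAt_symm (n := 1) x).continuousOn_tangentMapWithin le_rfl
      hU.uniqueMDiffOn).continuousAt <|
      (hU.preimage (FiberBundle.continuous_proj E _)).mem_nhds (mem_extChartAt_target x)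
  have hFx : F ⟨extChartAt J x x, u⟩ = ⟨x, u⟩ := by
    simp only [F, tangentMapWithin]
    rw [mfderivWithin_target_extChartAt_symm, extChartAt_to_inv]
    rfl
  have hG : ContinuousAt (fun w : E × E ↦ F ⟨w.1, w.2⟩) (extChartAt J x x, u) :=
    ContinuousAt.comp (g := F) (f := (tangentBundleModelSpaceHomeomorph 𝓘(ℝ, E)).symm)
      (x := (extChartAt J x x, u)) hF
      (tangentBundleModelSpaceHomeomorph 𝓘(ℝ, E)).symm.continuous.continuousAt
  have hmem : F ⟨extChartAt J x x, u⟩ ∈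
      {p : TangentBundle J M | IsFutureTimelike J g W p.proj p.2} := by
    rwa [hFx]
  exact hG.eventually (hopen.mem_nhds hmem)

theorem eventually_timelikeArc_of_extChartAt
    (hopen : IsOpen {p : TangentBundle J M | IsFutureTimelike J g W p.proj p.2})
    {x : M} {u : TangentSpace J x} (hu : IsFutureTimelike J g W x u) :
    ∀ᶠ w : (M × M) × E in 𝓝 ((x, x), u), ∀ s : ℝ, 0 < s →
      extChartAt J x w.1.2 = extChartAt J x w.1.1 + s • w.2 → TimelikeArc J g W w.1.1 w.1.2 := by
  obtain ⟨U, hU, N, hN, h⟩ := mem_nhds_prod_iff.1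
    (eventually_isFutureTimelike_mfderivWithin_extChartAt_symm hopen hu)
  obtain ⟨ε, hε, hball⟩ := Metric.mem_nhds_iff.1
    (Filter.inter_mem hU (extChartAt_target_mem_nhds (I := J) x))
  have hsource : {p : M | p ∈ (extChartAt J x).source ∧
      extChartAt J x p ∈ Metric.ball (extChartAt J x x) ε} ∈ 𝓝 x :=
    Filter.inter_mem (extChartAt_source_mem_nhds x)
      (continuousAt_extChartAt x (Metric.ball_mem_nhds _ hε))
  filter_upwards [prod_mem_nhds (prod_mem_nhds hsource hsource) hN]
  rintro ⟨⟨p, p'⟩, v⟩ ⟨⟨⟨hp, hpε⟩, hp', hpε'⟩, hv⟩ s hs heq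
  have hseg : ∀ σ ∈ Icc 0 s, extChartAt J x p + σ • v ∈ Metric.ball (extChartAt J x x) ε := by
    intro σ hσ
    have hmem := (convex_ball (extChartAt J x x) ε).add_smul_sub_mem hpε hpε'
      ⟨div_nonneg hσ.1 hs.le, div_le_one_of_le₀ hσ.2 hs.le⟩
    rwa [show extChartAt J x p' - extChartAt J x p = s • v from sub_eq_of_eq_add' heq, smul_smul,
      div_mul_cancel₀ σ hs.ne'] at hmem
  have harc := timelikeArc_extChartAt_symm hs (fun σ hσ ↦ (hball (hseg σ hσ)).2)
    fun σ hσ ↦ h (mk_mem_prod (hball (hseg σ hσ)).1 hv)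
  rwa [← heq, (extChartAt J x).left_inv hp, (extChartAt J x).left_inv hp'] at harc

theorem eventually_eventually_timelikeArc
    (hopen : IsOpen {p : TangentBundle J M | IsFutureTimelike J g W p.proj p.2})
    {ζ : ℝ → M} {u : TangentSpace J (ζ 0)}
    (hζ : HasMFDerivAt 𝓘(ℝ, ℝ) J ζ 0 (ContinuousLinearMap.toSpanSingleton ℝ u))
    (hu : IsFutureTimelike J g W (ζ 0) u) :
    ∀ᶠ s in 𝓝[≠] (0 : ℝ), ∀ᶠ p in 𝓝 (ζ 0),
      (0 < s → TimelikeArc J g W p (ζ s)) ∧ (s < 0 → TimelikeArc J g W (ζ s) p) := by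
  -- The segments from `p` to `ζ s` for `s > 0`, and from `ζ s` to `p` for `s < 0`, have the same
  -- velocity `s⁻¹ • (φ (ζ s) - φ p)` in the chart `φ`, which is close to `u`.
  have hslope : Filter.Tendsto (fun s : ℝ ↦ s⁻¹ • (extChartAt J (ζ 0) (ζ s) -
      extChartAt J (ζ 0) (ζ 0))) (𝓝[≠] 0) (𝓝 u) := by
    simpa [slope_fun_def] using tendsto_slope_extChartAt hζ
  have harc := eventually_timelikeArc_of_extChartAt hopen hu
  have hζ0 : Filter.Tendsto ζ (𝓝[≠] 0) (𝓝 (ζ 0)) := hζ.continuousAt.mono_left nhdsWithin_le_nhds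
  have hpast := ((hζ0.prodMk_nhds tendsto_const_nhds).prodMk_nhds hslope).eventually
    harc.eventually_nhds
  have hfuture := ((tendsto_const_nhds.prodMk_nhds hζ0).prodMk_nhds hslope).eventually
    harc.eventually_nhds
  filter_upwards [hpast, hfuture] with s hpast hfuture
  have hv : ContinuousAt (fun p ↦ s⁻¹ • (extChartAt J (ζ 0) (ζ s) - extChartAt J (ζ 0) p))
      (ζ 0) := (continuousAt_const.sub (continuousAt_extChartAt _)).const_smul _
  have hpast' := ((continuousAt_const.prodMk continuousAt_id).prodMk hv).eventually hpast
  have hfuture' := ((continuousAt_id.prodMk continuousAt_const).prodMk hv).eventually hfuture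
  filter_upwards [hpast', hfuture'] with p hpast hfuture
  refine ⟨fun hs ↦ hfuture s hs ?_, fun hs ↦ hpast (-s) (neg_pos.2 hs) ?_⟩
  · simp [smul_smul, hs.ne']
  · simp [smul_smul, hs.ne]

end Chart

end Chronology

noncomputable section

section Flow

variable {T : TopologicalSpace.Opens ℝ}

open Classical in
/-- The translation `t ↦ t + σ` of the time interval `T`, with the junk value `t` when `t + σ` is
not in `T`. -/
def timeShift (σ : ℝ) (t : T) : T :=
  if h : (t : ℝ) + σ ∈ T then ⟨t + σ, h⟩ else t

/-- The local flow of the vector field `∂_t + c ∂_y` on `T × Q × ℝ`, for the parameter `σ`. Where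
the flow leaves `T × Q × ℝ`, the time coordinate has the junk value of `timeShift`. -/
def flow {Q : Type*} (c σ : ℝ) (x : T × Q × ℝ) : T × Q × ℝ :=
  (timeShift σ x.1, x.2.1, x.2.2 + c * σ)

theorem coe_timeShift {σ : ℝ} {t : T} (h : (t : ℝ) + σ ∈ T) : (timeShift σ t : ℝ) = t + σ := by
  rw [timeShift, dif_pos h]

theorem eventually_coe_timeShift {σ : ℝ} {t : T} (h : (t : ℝ) + σ ∈ T) :
    ∀ᶠ p : ℝ × T in 𝓝 (σ, t), (timeShift p.1 p.2 : ℝ) = p.2 + p.1 := by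
  have hadd : Continuous fun p : ℝ × T ↦ (p.2 : ℝ) + p.1 := by fun_prop
  filter_upwards [hadd.continuousAt (T.isOpen.mem_nhds h)] with p hp using coe_timeShift hp

theorem eventually_add_mem (t : T) : ∀ᶠ σ in 𝓝 (0 : ℝ), (t : ℝ) + σ ∈ T :=
  (continuous_const.add continuous_id).tendsto' 0 (t : ℝ) (add_zero _) (T.isOpen.mem_nhds t.2)

theorem eventually_add_neg_mem (t : T) : ∀ᶠ σ in 𝓝 (0 : ℝ), (t : ℝ) + -σ ∈ T :=
  (continuous_neg.tendsto' (0 : ℝ) 0 neg_zero).eventually (eventually_add_mem t)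

theorem timeShift_zero (t : T) : timeShift 0 t = t :=
  Subtype.ext <| by rw [coe_timeShift (by simp), add_zero]

theorem timeShift_neg_timeShift {σ : ℝ} {t : T} (h : (t : ℝ) + σ ∈ T) :
    timeShift (-σ) (timeShift σ t) = t := by
  have ht : (timeShift σ t : ℝ) + -σ = t := by rw [coe_timeShift h, add_neg_cancel_right]
  exact Subtype.ext <| by rw [coe_timeShift (ht ▸ t.2), ht]

theorem contMDiffAt_timeShift {n : ℕ∞ω} {σ : ℝ} {t : T} (h : (t : ℝ) + σ ∈ T) :
    ContMDiffAt 𝓘(ℝ, ℝ) 𝓘(ℝ, ℝ) n (timeShift σ : T → T) t := by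
  have hadd : ContMDiff 𝓘(ℝ, ℝ) 𝓘(ℝ, ℝ) n fun s : T ↦ (s : ℝ) + σ :=
    contMDiff_subtype_val.add contMDiff_const
  exact contMDiffAt_subtypeVal_comp_iff.1 <| (hadd t).congr_of_eventuallyEq <|
    (Continuous.prodMk_right σ).continuousAt.eventually (eventually_coe_timeShift h)

theorem hasMFDerivAt_timeShift {σ : ℝ} {t : T} (h : (t : ℝ) + σ ∈ T) :
    HasMFDerivAt 𝓘(ℝ, ℝ) 𝓘(ℝ, ℝ) (timeShift σ : T → T) t (ContinuousLinearMap.id ℝ ℝ) := by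
  have hadd : HasMFDerivAt 𝓘(ℝ, ℝ) 𝓘(ℝ, ℝ) (fun s : T ↦ (s : ℝ) + σ) t
      (ContinuousLinearMap.id ℝ ℝ) :=
    ((hasFDerivAt_id (t : ℝ)).add_const σ).hasMFDerivAt.comp t (hasMFDerivAt_subtypeVal t)
  exact hasMFDerivAt_subtypeVal_comp_iff.1 <| hadd.congr_of_eventuallyEq <|
    (Continuous.prodMk_right σ).continuousAt.eventually (eventually_coe_timeShift h)

theorem hasMFDerivAt_timeShift_zero (t : T) :
    HasMFDerivAt 𝓘(ℝ, ℝ) 𝓘(ℝ, ℝ) (fun σ ↦ timeShift σ t) 0 (ContinuousLinearMap.id ℝ ℝ) := by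
  have hadd : HasMFDerivAt 𝓘(ℝ, ℝ) 𝓘(ℝ, ℝ) (fun σ : ℝ ↦ (t : ℝ) + σ) 0
      (ContinuousLinearMap.id ℝ ℝ) :=
    ((hasFDerivAt_id (0 : ℝ)).const_add (t : ℝ)).hasMFDerivAt
  exact hasMFDerivAt_subtypeVal_comp_iff.1 <| hadd.congr_of_eventuallyEq <|
    (Continuous.prodMk_left t).continuousAt.eventually (eventually_coe_timeShift (by simp))

variable {Q : Type*} {c σ : ℝ}

theorem flow_zero (x : T × Q × ℝ) : flow c 0 x = x := by
  simp only [flow, timeShift_zero, mul_zero, add_zero]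

theorem flow_neg_flow {x : T × Q × ℝ} (h : (x.1 : ℝ) + σ ∈ T) :
    flow c (-σ) (flow c σ x) = x := by
  simp only [flow, timeShift_neg_timeShift h, mul_neg, add_neg_cancel_right]

variable [TopologicalSpace Q]

theorem tendsto_flow_neg (c : ℝ) (x : T × Q × ℝ) :
    Filter.Tendsto (fun σ ↦ flow c (-σ) x) (𝓝 0) (𝓝 x) := by
  have h : ContinuousAt (fun σ ↦ flow c σ x) 0 :=
    (hasMFDerivAt_timeShift_zero x.1).continuousAt.prodMk (continuousAt_const.prodMk (by fun_prop))
  have h' := h.tendsto.comp (continuous_neg.tendsto' (0 : ℝ) 0 neg_zero)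
  rwa [flow_zero] at h'

variable {d : ℕ} [ChartedSpace (EuclideanSpace ℝ (Fin d)) Q]

theorem contMDiffAt_flow {n : ℕ∞ω} {x : T × Q × ℝ} (h : (x.1 : ℝ) + σ ∈ T) :
    ContMDiffAt (spacetimeModel d) (spacetimeModel d) n (flow c σ) x :=
  ((contMDiffAt_timeShift h).comp x contMDiffAt_fst).prodMk <|
    (contMDiffAt_fst.comp x contMDiffAt_snd).prodMk <|
      (contMDiffAt_snd.comp x contMDiffAt_snd).add contMDiffAt_const

theorem hasMFDerivAt_flow {x : T × Q × ℝ} (h : (x.1 : ℝ) + σ ∈ T) :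
    HasMFDerivAt (spacetimeModel d) (spacetimeModel d) (flow c σ) x
      (ContinuousLinearMap.id ℝ (ℝ × EuclideanSpace ℝ (Fin d) × ℝ)) :=
  ((hasMFDerivAt_timeShift h).comp x (hasMFDerivAt_fst _)).prodMk <|
    ((hasMFDerivAt_fst _).comp x (hasMFDerivAt_snd _)).prodMk <|
      (((hasFDerivAt_id x.2.2).add_const (c * σ)).hasMFDerivAt).comp x
        ((hasMFDerivAt_snd _).comp x (hasMFDerivAt_snd _))

end Flow

namespace MechanicalSystem

variable {r : ℕ∞ω} {d : ℕ} {T : TopologicalSpace.Opens ℝ} {Q : Type*}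
  [TopologicalSpace Q] [ChartedSpace (EuclideanSpace ℝ (Fin d)) Q]

theorem hasMFDerivAt_flow_zero (c : ℝ) (x : T × Q × ℝ) :
    HasMFDerivAt 𝓘(ℝ, ℝ) (spacetimeModel d) (fun σ ↦ flow c σ x) 0
      (ContinuousLinearMap.toSpanSingleton ℝ
        (partialT (d := d) (flow c 0 x) + c • partialY (flow c 0 x))) := by
  have hy : HasMFDerivAt 𝓘(ℝ, ℝ) 𝓘(ℝ, ℝ) (fun σ ↦ x.2.2 + c * σ) 0
      (c • ContinuousLinearMap.id ℝ ℝ) :=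
    (((hasFDerivAt_id (0 : ℝ)).const_mul c).const_add x.2.2).hasMFDerivAt
  have hflow := (hasMFDerivAt_timeShift_zero x.1).prodMk
    ((hasMFDerivAt_const (I' := 𝓡 d) x.2.1 (0 : ℝ)).prodMk hy)
  refine hflow.congr_mfderiv (ContinuousLinearMap.ext fun s : ℝ ↦ Eq.symm ?_)
  change s • (((1, 0, 0) : ℝ × EuclideanSpace ℝ (Fin d) × ℝ) + c • (0, 0, 1)) = (s, 0, c * s)
  simp [mul_comm]

theorem hasMFDerivAt_time (x : T × Q × ℝ) :
    HasMFDerivAt (spacetimeModel d) 𝓘(ℝ, ℝ) (fun x : T × Q × ℝ ↦ (x.1 : ℝ)) x (dt x) :=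
  (hasMFDerivAt_subtypeVal x.1).comp x (hasMFDerivAt_fst x)

theorem hasMFDerivAt_fst_snd (x : T × Q × ℝ) :
    HasMFDerivAt (spacetimeModel d) (𝓡 d) (fun x : T × Q × ℝ ↦ x.2.1) x (dq x) :=
  (hasMFDerivAt_fst x.2).comp x (hasMFDerivAt_snd x)

theorem hasMFDerivAt_snd_snd (x : T × Q × ℝ) :
    HasMFDerivAt (spacetimeModel d) 𝓘(ℝ, ℝ) (fun x : T × Q × ℝ ↦ x.2.2) x (dy x) :=
  (hasMFDerivAt_snd x.2).comp x (hasMFDerivAt_snd x)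

variable [IsManifold (𝓡 d) 1 Q]

theorem continuous_dt :
    Continuous fun p : TangentBundle (spacetimeModel d) (T × Q × ℝ) ↦ dt p.proj p.2 := by
  have h : ContMDiff (spacetimeModel d) 𝓘(ℝ, ℝ) 1 fun x : T × Q × ℝ ↦ (x.1 : ℝ) :=
    contMDiff_subtype_val.comp contMDiff_fst
  refine (continuous_mfderiv_apply h).congr fun p ↦ ?_
  rw [(hasMFDerivAt_time p.proj).mfderiv]
  rfl

theorem continuous_dy :
    Continuous fun p : TangentBundle (spacetimeModel d) (T × Q × ℝ) ↦ dy p.proj p.2 := by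
  have h : ContMDiff (spacetimeModel d) 𝓘(ℝ, ℝ) 1 fun x : T × Q × ℝ ↦ x.2.2 :=
    contMDiff_snd.comp contMDiff_snd
  refine (continuous_mfderiv_apply h).congr fun p ↦ ?_
  rw [(hasMFDerivAt_snd_snd p.proj).mfderiv]
  rfl

theorem continuous_dq :
    Continuous fun p : TangentBundle (spacetimeModel d) (T × Q × ℝ) ↦
      (⟨p.proj.2.1, dq p.proj p.2⟩ : TangentBundle (𝓡 d) Q) := by
  have h : ContMDiff (spacetimeModel d) (𝓡 d) 1 fun x : T × Q × ℝ ↦ x.2.1 :=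
    contMDiff_fst.comp contMDiff_snd
  refine (h.continuous_tangentMap le_rfl).congr fun p ↦ ?_
  rw [tangentMap, (hasMFDerivAt_fst_snd p.proj).mfderiv]

theorem isFutureTimelike_iff (S : MechanicalSystem r d T Q) (x : T × Q × ℝ)
    (u : TangentSpace (spacetimeModel d) x) :
    IsFutureTimelike (spacetimeModel d) S.metric S.timeOrientation x u ↔
      S.a x.1 x.2.1 (dq x u) (dq x u) <
        2 * dt x u * (dy x u - S.b x.1 x.2.1 (dq x u) + S.V x.1 x.2.1 * dt x u) ∧
      0 < dt x u / 2 + (dy x u - S.b x.1 x.2.1 (dq x u) + S.V x.1 x.2.1 * dt x u) := by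
  simp only [IsFutureTimelike, metric_apply, dt_timeOrientation, dq_timeOrientation,
    dy_timeOrientation, map_zero]
  constructor <;> rintro ⟨h, h'⟩ <;> constructor <;> linarith

theorem a_self_nonneg (S : MechanicalSystem r d T Q) (t : T) (q : Q)
    (v : TangentSpace (𝓡 d) q) : 0 ≤ S.a t q v v := by
  obtain rfl | hv := eq_or_ne v 0
  · simp
  · exact (S.a_pos t q v hv).le

variable {S : MechanicalSystem r d T Q}

theorem dt_pos_of_isFutureTimelike {x : T × Q × ℝ} {u : TangentSpace (spacetimeModel d) x}
    (hu : IsFutureTimelike (spacetimeModel d) S.metric S.timeOrientation x u) : 0 < dt x u := by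
  obtain ⟨hself, hW⟩ := (S.isFutureTimelike_iff x u).1 hu
  have ha := S.a_self_nonneg x.1 x.2.1 (dq x u)
  by_contra! ht
  have hω : 0 < dy x u - S.b x.1 x.2.1 (dq x u) + S.V x.1 x.2.1 * dt x u := by linarith
  have hmul := mul_nonpos_of_nonpos_of_nonneg ht hω.le
  linarith

theorem isTemporal_time (S : MechanicalSystem r d T Q) :
    IsTemporal (spacetimeModel d) S.metric S.timeOrientation (fun x : T × Q × ℝ ↦ (x.1 : ℝ)) where
  mdifferentiable x := (hasMFDerivAt_time x).mdifferentiableAt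
  mfderiv_pos x u hu := by
    rw [(hasMFDerivAt_time x).mfderiv]
    exact dt_pos_of_isFutureTimelike hu

theorem isFutureTimelike_partialT_add_smul_partialY {c : ℝ} {x : T × Q × ℝ}
    (hc : -S.V x.1 x.2.1 < c) :
    IsFutureTimelike (spacetimeModel d) S.metric S.timeOrientation x
      (partialT x + c • partialY x) := by
  have ht : dt x (partialT (d := d) x + c • partialY x) = 1 := by
    change (1 : ℝ) + c * 0 = 1
    ring
  have hq : dq x (partialT (d := d) x + c • partialY x) = 0 := by
    change (0 : EuclideanSpace ℝ (Fin d)) + c • (0 : EuclideanSpace ℝ (Fin d)) = 0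
    simp
  have hy : dy x (partialT (d := d) x + c • partialY x) = c := by
    change (0 : ℝ) + c * 1 = c
    ring
  rw [isFutureTimelike_iff, ht, hq, hy]
  simp only [map_zero]
  constructor <;> linarith

theorem continuous_b (S : MechanicalSystem r d T Q) :
    Continuous fun p : T × TangentBundle (𝓡 d) Q ↦ S.b p.1 p.2.proj p.2.2 := by
  have hb : ContMDiff (𝓘(ℝ, ℝ).prod (𝓡 d).tangent)
      ((𝓡 d).prod 𝓘(ℝ, EuclideanSpace ℝ (Fin d) →L[ℝ] ℝ)) 0
      (fun p : T × TangentBundle (𝓡 d) Q ↦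
        Bundle.TotalSpace.mk' (EuclideanSpace ℝ (Fin d) →L[ℝ] ℝ)
          (E := fun q : Q ↦ TangentSpace (𝓡 d) q →L[ℝ] Bundle.Trivial Q ℝ q)
          p.2.proj (S.b p.1 p.2.proj)) :=
    (S.contMDiff_b.of_le zero_le).comp
      (contMDiff_fst.prodMk ((Bundle.contMDiff_proj _).comp contMDiff_snd))
  have h := ContMDiff.clm_bundle_apply (n := 0) (F₁ := EuclideanSpace ℝ (Fin d)) (F₂ := ℝ)
    (E₂ := Bundle.Trivial Q ℝ)
    (b := fun p : T × TangentBundle (𝓡 d) Q ↦ p.2.proj) hb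
    (v := fun p : T × TangentBundle (𝓡 d) Q ↦ p.2.2) contMDiff_snd
  have hvalue : ContMDiff (𝓘(ℝ, ℝ).prod (𝓡 d).tangent) 𝓘(ℝ, ℝ) 0
      fun p : T × TangentBundle (𝓡 d) Q ↦ S.b p.1 p.2.proj p.2.2 :=
    fun p ↦ ((Bundle.contMDiffAt_totalSpace ..).1 (h p)).2
  exact hvalue.continuous

theorem continuous_a (S : MechanicalSystem r d T Q) :
    Continuous fun p : T × TangentBundle (𝓡 d) Q ↦ S.a p.1 p.2.proj p.2.2 p.2.2 := by
  have ha : ContMDiff (𝓘(ℝ, ℝ).prod (𝓡 d).tangent)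
      ((𝓡 d).prod 𝓘(ℝ, EuclideanSpace ℝ (Fin d) →L[ℝ] EuclideanSpace ℝ (Fin d) →L[ℝ] ℝ)) 0
      (fun p : T × TangentBundle (𝓡 d) Q ↦
        Bundle.TotalSpace.mk' (EuclideanSpace ℝ (Fin d) →L[ℝ] EuclideanSpace ℝ (Fin d) →L[ℝ] ℝ)
          (E := fun q : Q ↦
            TangentSpace (𝓡 d) q →L[ℝ] TangentSpace (𝓡 d) q →L[ℝ] Bundle.Trivial Q ℝ q)
          p.2.proj (S.a p.1 p.2.proj)) :=
    (S.contMDiff_a.of_le zero_le).comp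
      (contMDiff_fst.prodMk ((Bundle.contMDiff_proj _).comp contMDiff_snd))
  have h := ContMDiff.clm_bundle_apply₂ (n := 0) (F₁ := EuclideanSpace ℝ (Fin d))
    (F₂ := EuclideanSpace ℝ (Fin d)) (F₃ := ℝ) (E₃ := Bundle.Trivial Q ℝ)
    (b := fun p : T × TangentBundle (𝓡 d) Q ↦ p.2.proj) ha
    (v := fun p : T × TangentBundle (𝓡 d) Q ↦ p.2.2)
    (w := fun p : T × TangentBundle (𝓡 d) Q ↦ p.2.2)
    contMDiff_snd contMDiff_snd
  have hvalue : ContMDiff (𝓘(ℝ, ℝ).prod (𝓡 d).tangent) 𝓘(ℝ, ℝ) 0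
      fun p : T × TangentBundle (𝓡 d) Q ↦ S.a p.1 p.2.proj p.2.2 p.2.2 :=
    fun p ↦ ((Bundle.contMDiffAt_totalSpace ..).1 (h p)).2
  exact hvalue.continuous

theorem isOpen_setOf_isFutureTimelike (S : MechanicalSystem r d T Q) :
    IsOpen {p : TangentBundle (spacetimeModel d) (T × Q × ℝ) |
      IsFutureTimelike (spacetimeModel d) S.metric S.timeOrientation p.proj p.2} := by
  have hproj : Continuous fun p : TangentBundle (spacetimeModel d) (T × Q × ℝ) ↦ p.proj :=
    FiberBundle.continuous_proj _ _
  have hdq := (continuous_fst.comp hproj).prodMk (continuous_dq (d := d) (T := T) (Q := Q))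
  have ha := S.continuous_a.comp hdq
  have hb := S.continuous_b.comp hdq
  have hV := S.contMDiff_V.continuous.comp
    ((continuous_fst.comp hproj).prodMk (continuous_fst.comp (continuous_snd.comp hproj)))
  have hdt := continuous_dt (d := d) (T := T) (Q := Q)
  have hdy := continuous_dy (d := d) (T := T) (Q := Q)
  simp only [Function.comp_def] at ha hb hV
  simp only [isFutureTimelike_iff, ofPred_and]
  refine (isOpen_lt ?_ ?_).inter (isOpen_lt continuous_const ?_) <;> fun_prop

theorem eventually_eventually_timelikeArc_flow {c : ℝ} {x : T × Q × ℝ}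
    (hc : -S.V x.1 x.2.1 < c) :
    ∀ᶠ σ in 𝓝[≠] (0 : ℝ), ∀ᶠ p in 𝓝 x,
      (0 < σ → TimelikeArc (spacetimeModel d) S.metric S.timeOrientation p (flow c σ x)) ∧
      (σ < 0 → TimelikeArc (spacetimeModel d) S.metric S.timeOrientation (flow c σ x) p) := by
  have hu := isFutureTimelike_partialT_add_smul_partialY (S := S) (x := flow c 0 x) (c := c)
    (by rwa [flow_zero])
  simpa only [flow_zero] using eventually_eventually_timelikeArc S.isOpen_setOf_isFutureTimelike
    (hasMFDerivAt_flow_zero c x) hu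

theorem IsAutonomous.V_eq (hS : S.IsAutonomous) (t s : T) (q : Q) : S.V t q = S.V s q := by
  have h := hS t s q 0
  simp only [lagrangian, map_zero] at h
  linarith

theorem IsAutonomous.b_eq (hS : S.IsAutonomous) (t s : T) (q : Q) (v : TangentSpace (𝓡 d) q) :
    S.b t q v = S.b s q v := by
  have h := hS t s q v
  have h' := hS t s q (-v)
  simp only [lagrangian, map_neg, neg_apply] at h h'
  linarith

theorem IsAutonomous.a_eq (hS : S.IsAutonomous) (t s : T) (q : Q) (v : TangentSpace (𝓡 d) q) :
    S.a t q v v = S.a s q v v := by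
  have h := hS t s q v
  have hb := hS.b_eq t s q v
  have hV := hS.V_eq t s q
  simp only [lagrangian] at h
  linarith

theorem IsAutonomous.isFutureTimelike_flow (hS : S.IsAutonomous) {c σ : ℝ} {x : T × Q × ℝ}
    {u : TangentSpace (spacetimeModel d) x}
    (hu : IsFutureTimelike (spacetimeModel d) S.metric S.timeOrientation x u) :
    IsFutureTimelike (spacetimeModel d) S.metric S.timeOrientation (flow c σ x) u := by
  refine (S.isFutureTimelike_iff (flow c σ x) u).2 ?_
  rw [hS.a_eq _ x.1, hS.b_eq _ x.1, hS.V_eq _ x.1]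
  exact (S.isFutureTimelike_iff x u).1 hu

theorem IsAutonomous.chronological_flow (hS : S.IsAutonomous) (hT : OrdConnected (T : Set ℝ))
    {c σ : ℝ} {x z : T × Q × ℝ} (hx : (x.1 : ℝ) + σ ∈ T) (hz : (z.1 : ℝ) + σ ∈ T)
    (h : Chronological (spacetimeModel d) S.metric S.timeOrientation x z) :
    Chronological (spacetimeModel d) S.metric S.timeOrientation (flow c σ x) (flow c σ z) := by
  have hmem : ∀ y : T × Q × ℝ, (y.1 : ℝ) ∈ Icc (x.1 : ℝ) z.1 → (y.1 : ℝ) + σ ∈ T := fun y hy ↦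
    hT.out hx hz ⟨by linarith [hy.1], by linarith [hy.2]⟩
  refine h.map S.isTemporal_time (fun y hy ↦ contMDiffAt_flow (hmem y hy)) fun y hy u hu ↦ ?_
  rw [(hasMFDerivAt_flow (hmem y hy)).mfderiv]
  exact hS.isFutureTimelike_flow hu

theorem IsAutonomous.pastReflective (hS : S.IsAutonomous) (hT : OrdConnected (T : Set ℝ)) :
    PastReflective (spacetimeModel d) S.metric S.timeOrientation := by
  intro x z hz
  obtain ⟨c, hc⟩ := exists_gt (-S.V z.1 z.2.1)
  have hlim : Filter.Tendsto (fun σ ↦ flow c (-σ) x) (𝓝[>] 0) (𝓝 x) :=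
    (tendsto_flow_neg c x).mono_left nhdsWithin_le_nhds
  refine mem_closure_of_tendsto hlim ?_
  filter_upwards [self_mem_nhdsWithin,
    nhdsGT_le_nhdsNE 0 (eventually_eventually_timelikeArc_flow hc),
    nhdsWithin_le_nhds (eventually_add_mem z.1),
    nhdsWithin_le_nhds (eventually_add_neg_mem x.1)] with σ hσ harc hzσ hxσ
  obtain ⟨p, hxp, hpz⟩ := ((mem_closure_iff_frequently.1 hz).and_eventually harc).exists
  have hz' : ((flow c σ z).1 : ℝ) + -σ ∈ T := by simp [flow, coe_timeShift hzσ]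
  have hxz := hS.chronological_flow hT (c := c) hxσ hz' (hxp.tail (hpz.1 hσ))
  rwa [flow_neg_flow hzσ] at hxz

theorem IsAutonomous.futureReflective (hS : S.IsAutonomous) (hT : OrdConnected (T : Set ℝ)) :
    FutureReflective (spacetimeModel d) S.metric S.timeOrientation := by
  intro x z hx
  obtain ⟨c, hc⟩ := exists_gt (-S.V x.1 x.2.1)
  have hlim : Filter.Tendsto (fun σ ↦ flow c (-σ) z) (𝓝[<] 0) (𝓝 z) :=
    (tendsto_flow_neg c z).mono_left nhdsWithin_le_nhds
  refine mem_closure_of_tendsto hlim ?_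
  filter_upwards [self_mem_nhdsWithin,
    nhdsLT_le_nhdsNE 0 (eventually_eventually_timelikeArc_flow hc),
    nhdsWithin_le_nhds (eventually_add_mem x.1),
    nhdsWithin_le_nhds (eventually_add_neg_mem z.1)] with σ hσ harc hxσ hzσ
  obtain ⟨p, hpz, hxp⟩ := ((mem_closure_iff_frequently.1 hx).and_eventually harc).exists
  have hx' : ((flow c σ x).1 : ℝ) + -σ ∈ T := by simp [flow, coe_timeShift hxσ]
  have hxz := hS.chronological_flow hT (c := c) hx' hzσ (hpz.head (hxp.2 hσ))
  rwa [flow_neg_flow hxσ] at hxz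

end MechanicalSystem

end

theorem theorem4p10_general {r : ℕ∞ω} {d : ℕ} {T : TopologicalSpace.Opens ℝ}
    (hT : IsPreconnected (T : Set ℝ)) {Q : Type*} [TopologicalSpace Q]
    [ChartedSpace (EuclideanSpace ℝ (Fin d)) Q] [IsManifold (𝓡 d) 1 Q]
    (S : MechanicalSystem r d T Q) (hS : S.IsAutonomous) :
    Reflective (spacetimeModel d) S.metric S.timeOrientation :=
  ⟨hS.pastReflective hT.ordConnected, hS.futureReflective hT.ordConnected⟩

theorem theorem4p10 (r : ℕ∞ω) (hr : 2 ≤ r) (d : ℕ)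
    (T : TopologicalSpace.Opens ℝ) (hT : IsConnected (T : Set ℝ))
    (Q : Type*) [TopologicalSpace Q] [T2Space Q] [ParacompactSpace Q] [ConnectedSpace Q]
    [ChartedSpace (EuclideanSpace ℝ (Fin d)) Q]
    [IsManifold (𝓡 d) 1 Q] [IsManifold (𝓡 d) (r + 1) Q]
    (S : MechanicalSystem r d T Q) (hS : S.IsAutonomous) :
    Reflective (spacetimeModel d) S.metric S.timeOrientation :=
  theorem4p10_general hT.isPreconnected S hS
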